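/- Let $\phi=\frac{1+\sqrt5}{2}$ (so $\phi^3=2+\sqrt5$), let $\mathbf S=\{x^2+y^2+z^2=1\}\subset\mathbb R^3$ be the unit sphere, and for $\xi\in\mathbb R$ let $$\mathbf T_\xi=\{(x,y,z)\in\mathbb R^3:\ (\phi^2x^2-y^2)(\phi^2y^2-z^2)(\phi^2z^2-x^2)=\xi\}.$$ Let $$\varpi(x,y,z)=\frac{(5-\sqrt5)yz^5+(5+\sqrt5)y^5z-20y^3z^3+(10+10\sqrt5)x^2yz^3+(10-10\sqrt5)x^2y^3z-10x^4yz}{(x^2+y^2+z^2)^2},$$ and call a point of $\mathbf S$ a fixed point of the icosahedral superflow if the vector field $\big(\varpi(x,y,z),\varpi(y,z,x),\varpi(z,x,y)\big)$ vanishes there. Then the intersection $\mathbf S\cap\mathbf T_\xi$: i) is empty for $\xi<-\frac{\phi^3}{5}=-\frac{2+\sqrt5}{5}$; ii) is equal to $12$ isolated points for $\xi=-\frac{2+\sqrt5}{5}$; iii) consists of $12$ pairwise disjoint curves, each homeomorphic to a circle, for $-\frac{2+\sqrt5}{5}<\xi<0$; iv) for $\xi=0$, is the union of $60$ closed arcs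 of great circles of $\mathbf S$, each of which begins and ends at a fixed point of the superflow and contains no other fixed point, and any two of which have at most endpoints in common; v) consists of $20$ pairwise disjoint curves, each homeomorphic to a circle, for $0<\xi<\frac{\phi^3}{27}=\frac{2+\sqrt5}{27}$; vi) is equal to $20$ isolated points for $\xi=\frac{2+\sqrt5}{27}$; vii) is empty for $\xi>\frac{2+\sqrt5}{27}$. -/

import Mathlib

open Real Set

noncomputable section

namespace Icosahedral

/-- Euclidean three-space. -/
abbrev E3 : Type := EuclideanSpace ℝ (Fin 3)

/-- The unit sphere of Euclidean three-space. -/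
def unitSphere : Set E3 := Metric.sphere (0 : E3) 1

/-- The sextic form `(φ²x² - y²)(φ²y² - z²)(φ²z² - x²)`, with `φ = (1 + √5) / 2`. -/
def V (p : E3) : ℝ :=
  (goldenRatio ^ 2 * p 0 ^ 2 - p 1 ^ 2) * (goldenRatio ^ 2 * p 1 ^ 2 - p 2 ^ 2) *
    (goldenRatio ^ 2 * p 2 ^ 2 - p 0 ^ 2)

/-- The algebraic surface `V = ξ`. -/
def surfaceT (ξ : ℝ) : Set E3 := {p | V p = ξ}

/-- The first component of the icosahedral vector field; the other two arise from it by
cyclically permuting the variables. -/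
def fieldComponent (x y z : ℝ) : ℝ :=
  ((5 - √5) * y * z ^ 5 + (5 + √5) * y ^ 5 * z - 20 * y ^ 3 * z ^ 3
      + (10 + 10 * √5) * x ^ 2 * y * z ^ 3 + (10 - 10 * √5) * x ^ 2 * y ^ 3 * z
      - 10 * x ^ 4 * y * z) / (x ^ 2 + y ^ 2 + z ^ 2) ^ 2

/-- The vector field of the icosahedral superflow. -/
def vectorField (p : E3) : E3 :=
  !₂[fieldComponent (p 0) (p 1) (p 2), fieldComponent (p 1) (p 2) (p 0),
    fieldComponent (p 2) (p 0) (p 1)]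

/-- The fixed points of the icosahedral superflow: the points where its vector field vanishes. -/
def IsFixedPoint (p : E3) : Prop := vectorField p = 0

/-- A nondegenerate closed arc of a great circle of the unit sphere, shorter than the full
circle: `t ↦ cos t • u + sin t • v` for `0 ≤ t ≤ length`, where `u`, `v` are orthonormal. -/
structure GreatCircleArc where
  u : E3
  v : E3
  length : ℝ
  norm_u : ‖u‖ = 1
  norm_v : ‖v‖ = 1
  inner_eq_zero : inner ℝ u v = 0
  length_pos : 0 < length
  length_lt : length < 2 * π

namespace GreatCircleArc

/-- The parametrization of the great circle by arc length. -/
def param (A : GreatCircleArc) (t : ℝ) : E3 := cos t • A.u + sin t • A.v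

/-- The closed arc as a subset of space. -/
def carrier (A : GreatCircleArc) : Set E3 := A.param '' Icc 0 A.length

/-- The arc without its two endpoints. -/
def openArc (A : GreatCircleArc) : Set E3 := A.param '' Ioo 0 A.length

/-- The two endpoints of the arc. -/
def endpoints (A : GreatCircleArc) : Set E3 := {A.param 0, A.param A.length}

end GreatCircleArc

/-- `s` consists of exactly `n` isolated points. -/
def ConsistsOfIsolatedPoints (n : ℕ) (s : Set E3) : Prop :=
  s.encard = n ∧ DiscreteTopology s

/-- `s` is the union of `n` pairwise disjoint curves, each homeomorphic to a circle. -/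
def ConsistsOfDisjointCircles (n : ℕ) (s : Set E3) : Prop :=
  ∃ C : Fin n → Set E3,
    (∀ i, Nonempty (C i ≃ₜ Circle)) ∧
    (Pairwise fun i j => Disjoint (C i) (C j)) ∧
    s = ⋃ i, C i

/-- `s` is the union of `n` great-circle arcs, each of which begins and ends at a fixed point of
the superflow and has no fixed point in between, and any two of which have at most endpoints in
common. -/
def ConsistsOfFixedPointArcs (n : ℕ) (s : Set E3) : Prop :=
  ∃ A : Fin n → GreatCircleArc,
    (∀ i, ∀ p ∈ (A i).endpoints, IsFixedPoint p) ∧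
    (∀ i, ∀ p ∈ (A i).openArc, ¬ IsFixedPoint p) ∧
    (Pairwise fun i j =>
      (A i).carrier ∩ (A j).carrier ⊆ (A i).endpoints ∩ (A j).endpoints) ∧
    s = ⋃ i, (A i).carrier

end Icosahedral

end

/-!
`V` is the product of the six linear forms `⟪axis i, ·⟫`, where `± axis i` are the twelve vertices
of an icosahedron. The six great circles `V = 0` are the edges of an icosidodecahedron, which has
12 pentagonal faces, where `V < 0`, 20 triangular faces, where `V > 0`, and 60 edges.

*Faces.* On a face all six forms, taken with suitable signs, are positive. Along a great circle
through the centre `c` of the face each form is `⟪a, c⟫ (cos t + b sin t)`, and the six slopes `b`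
have sum zero because `c` is a critical point of the product. Hence the product is
`K (cos t) ^ 6 ∏ (1 + b tan t)`; by `1 + x ≤ exp x` and Bernoulli's inequality the last factor
does not increase with `t` in `[0, π / 2)`, so that `|V|` decreases strictly from `K` at the centre
to zero on the boundary. The level curve at height `k < K` therefore meets each ray from the
centre once, and projection to the directions at `c`, a continuous bijection from a compact space,
is a homeomorphism to the circle (`IsFaceCentre.nonempty_faceLevel_homeomorph_circle`).

*Sign vectors.* The inner products of the axes are `φ (√5 I + A)`, where `A` is an integer matrix
with eigenvalue `√5` on the family of axes (`sum_axisSign_smul_axis`). For a sign vector `s` the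
row sums of the matrix `s i * A i j * s j` tell everything: either they are all at most `1`, and
the eigenvector relation shows that `s` is not realized by a point of the sphere; or they are
`5, 1, 1, 1, 1, 1` (12 pentagons) or `3, 3, 3, -1, -1, -1` (20 triangles), in some order, and
`∑ i, s i • axis i` spans the symmetry axis of the face. The trichotomy and the two numbers are a
finite check over the 64 sign vectors.

*Edges.* On each of the six great circles, parametrized by arc length, the other five forms have
product proportional to `sin (5 θ)`, and the vector field is a nonzero constant times this product
in the tangent direction. So the fixed points on the circle are its ten crossing points with the other circles,
which cut it into ten arcs of length `π / 5`.
-/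

open Real Set

noncomputable section

namespace Icosahedral

/-! ### Level curves of a product of linear forms on a face -/

theorem prod_one_add_le_one {ι : Type*} [Fintype ι] {b : ι → ℝ} (hsum : ∑ i, b i = 0)
    (hb : ∀ i, 0 < 1 + b i) : ∏ i, (1 + b i) ≤ 1 := by
  calc ∏ i, (1 + b i) ≤ ∏ i, Real.exp (b i) :=
        Finset.prod_le_prod (fun i _ => (hb i).le) fun i _ => by
          linarith [Real.add_one_le_exp (b i)]
    _ = 1 := by rw [← Real.exp_sum, hsum, Real.exp_zero]

/-- Bernoulli's inequality, multiplied over a family of slopes with sum zero. -/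
theorem prod_one_add_le_prod_one_add_mul {ι : Type*} [Fintype ι] {b : ι → ℝ}
    (hsum : ∑ i, b i = 0) (hb : ∀ i, 0 < 1 + b i) {r : ℝ} (hr0 : 0 ≤ r) (hr1 : r ≤ 1) :
    ∏ i, (1 + b i) ≤ ∏ i, (1 + r * b i) := by
  have hpos : 0 < ∏ i, (1 + b i) := Finset.prod_pos fun i _ => hb i
  calc ∏ i, (1 + b i) ≤ (∏ i, (1 + b i)) ^ r := by
        simpa using Real.rpow_le_rpow_of_exponent_ge hpos (prod_one_add_le_one hsum hb) hr1
    _ = ∏ i, (1 + b i) ^ r := (Real.finsetProd_rpow _ _ (fun i _ => (hb i).le) r).symm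
    _ ≤ ∏ i, (1 + r * b i) :=
        Finset.prod_le_prod (fun i _ => Real.rpow_nonneg (hb i).le r) fun i _ =>
          rpow_one_add_le_one_add_mul_self (by linarith [hb i]) hr0 hr1

/-- The unit vector `c` lies in the open cone `⟪a i, ·⟫ > 0`, and is a critical point of the
restriction of `∏ i, ⟪a i, ·⟫` to the sphere: `critical` says that the logarithm of the product
has derivative zero at `c` in the tangent direction `u`. -/
structure IsFaceCentre {ι : Type*} [Fintype ι] (a : ι → E3) (c : E3) : Prop where
  norm_eq : ‖c‖ = 1
  pos : ∀ i, 0 < inner ℝ (a i) c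
  critical : ∀ u : E3, inner ℝ c u = 0 → ∑ i, inner ℝ (a i) u / inner ℝ (a i) c = 0

/-- The part of the level set `∏ i, ⟪a i, ·⟫ = k` of the sphere in the open cone
`⟪a i, ·⟫ > 0`. -/
def faceLevel {ι : Type*} [Fintype ι] (a : ι → E3) (k : ℝ) : Set E3 :=
  {p | p ∈ unitSphere ∧ (∀ i, 0 < inner ℝ (a i) p) ∧ ∏ i, inner ℝ (a i) p = k}

theorem mem_unitSphere {p : E3} : p ∈ unitSphere ↔ ‖p‖ = 1 := by
  simp [unitSphere]

namespace IsFaceCentre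

variable {ι : Type*} [Fintype ι] {a : ι → E3} {c : E3}

theorem inner_self_eq_one (h : IsFaceCentre a c) : inner ℝ c c = (1 : ℝ) := by
  rw [real_inner_self_eq_norm_sq, h.norm_eq]; norm_num

/-- In the decomposition `p = α c + β u` with `u ⟂ c`, the numbers `⟪a i, p⟫ / ⟪a i, c⟫` have
mean `α`; so `α > 0` throughout the cone. -/
theorem coeff_pos [Nonempty ι] (h : IsFaceCentre a c) {u : E3} (hu : inner ℝ c u = 0) {α β : ℝ}
    (hp : ∀ i, 0 < inner ℝ (a i) (α • c + β • u)) : 0 < α := by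
  have h1 : ∑ i, inner ℝ (a i) (α • c + β • u) / inner ℝ (a i) c = Fintype.card ι * α := by
    have : ∀ i, inner ℝ (a i) (α • c + β • u) / inner ℝ (a i) c
        = α + β * (inner ℝ (a i) u / inner ℝ (a i) c) := fun i => by
      have := (h.pos i).ne'
      rw [inner_add_right, inner_smul_right, inner_smul_right]
      field_simp
    simp_rw [this, Finset.sum_add_distrib, ← Finset.mul_sum, h.critical u hu]
    simp
  have h2 : 0 < ∑ i, inner ℝ (a i) (α • c + β • u) / inner ℝ (a i) c :=
    Finset.sum_pos (fun i _ => div_pos (hp i) (h.pos i)) Finset.univ_nonempty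
  rw [h1] at h2
  exact pos_of_mul_pos_right h2 (Nat.cast_nonneg _)

theorem prod_inner_eq (h : IsFaceCentre a c) (u : E3) {α β : ℝ} (hα : α ≠ 0) :
    ∏ i, inner ℝ (a i) (α • c + β • u) = (∏ i, inner ℝ (a i) c) * α ^ Fintype.card ι *
      ∏ i, (1 + β / α * (inner ℝ (a i) u / inner ℝ (a i) c)) := by
  rw [← Finset.card_univ, ← Finset.prod_const, ← Finset.prod_mul_distrib,
    ← Finset.prod_mul_distrib]
  refine Finset.prod_congr rfl fun i _ => ?_
  have := (h.pos i).ne'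
  rw [inner_add_right, inner_smul_right, inner_smul_right]
  field_simp

theorem factor_pos (h : IsFaceCentre a c) {u : E3} {α β : ℝ} (hα : 0 < α)
    (hp : ∀ i, 0 < inner ℝ (a i) (α • c + β • u)) (i : ι) :
    0 < 1 + β / α * (inner ℝ (a i) u / inner ℝ (a i) c) := by
  have hc := h.pos i
  have := hp i
  rw [inner_add_right, inner_smul_right, inner_smul_right] at this
  have h2 : 1 + β / α * (inner ℝ (a i) u / inner ℝ (a i) c)
      = (α * inner ℝ (a i) c + β * inner ℝ (a i) u) / (α * inner ℝ (a i) c) := by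
    field_simp
  rw [h2]; positivity

theorem sum_factor (h : IsFaceCentre a c) {u : E3} (hu : inner ℝ c u = 0) (r : ℝ) :
    ∑ i, r * (inner ℝ (a i) u / inner ℝ (a i) c) = 0 := by
  rw [← Finset.mul_sum, h.critical u hu, mul_zero]

theorem norm_sq_eq (h : IsFaceCentre a c) {u : E3} (hu : inner ℝ c u = 0) (α β : ℝ) :
    ‖α • c + β • u‖ ^ 2 = α ^ 2 + β ^ 2 * ‖u‖ ^ 2 := by
  rw [norm_add_sq_real, norm_smul, norm_smul, inner_smul_left, inner_smul_right, hu, mul_pow,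
    mul_pow, h.norm_eq]
  simp

/-- The product of the forms decreases strictly along each quarter great circle that leaves the
centre, as long as the forms stay positive. -/
theorem prod_inner_lt [Nonempty ι] (h : IsFaceCentre a c) {u : E3} (hu : inner ℝ c u = 0)
    {α β α' β' : ℝ} (hβ : 0 ≤ β) (hlt : β < β') (h1 : α ^ 2 + β ^ 2 = 1) (h1' : α' ^ 2 + β' ^ 2 = 1)
    (hα : 0 < α) (hp' : ∀ i, 0 < inner ℝ (a i) (α' • c + β' • u)) :
    ∏ i, inner ℝ (a i) (α' • c + β' • u) < ∏ i, inner ℝ (a i) (α • c + β • u) := by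
  have hα' : 0 < α' := h.coeff_pos hu hp'
  have hβ' : 0 < β' := hβ.trans_lt hlt
  have hαα : α' < α := by nlinarith
  have hK : 0 < ∏ i, inner ℝ (a i) c := Finset.prod_pos fun i _ => h.pos i
  have hf := h.factor_pos hα' hp'
  have hP := Finset.prod_pos fun i (_ : i ∈ Finset.univ) => hf i
  -- Bernoulli's inequality with exponent the ratio of the two slopes `β / α` and `β' / α'`.
  have hmono := prod_one_add_le_prod_one_add_mul (h.sum_factor hu (β' / α')) hf
    (r := (β / α) / (β' / α')) (by positivity)
    (by
      rw [div_le_one (by positivity)]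
      exact div_le_div₀ hβ'.le hlt.le hα' hαα.le)
  have hcancel : ∀ i, (β / α) / (β' / α') * (β' / α' * (inner ℝ (a i) u / inner ℝ (a i) c))
      = β / α * (inner ℝ (a i) u / inner ℝ (a i) c) := fun i => by field_simp
  simp_rw [hcancel] at hmono
  rw [h.prod_inner_eq u hα.ne', h.prod_inner_eq u hα'.ne']
  have hpow : α' ^ Fintype.card ι < α ^ Fintype.card ι :=
    pow_lt_pow_left₀ hαα hα'.le Fintype.card_ne_zero
  calc _ < (∏ i, inner ℝ (a i) c) * α ^ Fintype.card ι *
      ∏ i, (1 + β' / α' * (inner ℝ (a i) u / inner ℝ (a i) c)) := by gcongr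
    _ ≤ _ := by gcongr

theorem inner_sub_smul (h : IsFaceCentre a c) (p : E3) :
    inner ℝ c (p - inner ℝ c p • c) = (0 : ℝ) := by
  rw [inner_sub_right, inner_smul_right, h.inner_self_eq_one]; ring

/-- The centre is the only maximum of the product in the cone. -/
theorem prod_inner_lt_of_ne [Nonempty ι] (h : IsFaceCentre a c) {p : E3} (hp : p ∈ unitSphere)
    (hpos : ∀ i, 0 < inner ℝ (a i) p) (hne : p ≠ c) :
    ∏ i, inner ℝ (a i) p < ∏ i, inner ℝ (a i) c := by
  rw [mem_unitSphere] at hp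
  obtain ⟨q, hq⟩ : ∃ q, q = p - inner ℝ c p • c := ⟨_, rfl⟩
  have hu := h.inner_sub_smul p
  rw [← hq] at hu
  have hdec : p = inner ℝ c p • c + q := by rw [hq]; abel
  have hq0 : q ≠ 0 := by
    intro h0
    have hd := hdec
    rw [h0, add_zero] at hd
    have hα : (0 : ℝ) < inner ℝ c p := by
      refine h.coeff_pos (u := (0 : E3)) (β := 0) (by simp) ?_
      simpa [← hd] using hpos
    have := congrArg norm hd
    rw [norm_smul, hp, h.norm_eq, Real.norm_of_nonneg hα.le, mul_one] at this
    exact hne (by rw [hd, ← this, one_smul])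
  have hq0' : 0 < ‖q‖ := norm_pos_iff.2 hq0
  have hdec' : p = inner ℝ c p • c + ‖q‖ • (‖q‖⁻¹ • q) := by
    rw [smul_smul, mul_inv_cancel₀ hq0'.ne', one_smul]; exact hdec
  have hu' : inner ℝ c (‖q‖⁻¹ • q) = (0 : ℝ) := by rw [inner_smul_right, hu, mul_zero]
  have hn : (inner ℝ c p) ^ 2 + ‖q‖ ^ 2 = (1 : ℝ) := by
    have := h.norm_sq_eq hu (inner ℝ c p) 1
    rw [one_smul, ← hdec, hp] at this
    linarith
  have := h.prod_inner_lt hu' le_rfl hq0' (α := 1) (by norm_num) hn one_pos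
    (by rw [← hdec']; exact hpos)
  rw [← hdec'] at this
  simpa using this

theorem mem_unitSphere (h : IsFaceCentre a c) : c ∈ unitSphere :=
  Icosahedral.mem_unitSphere.2 h.norm_eq

theorem faceLevel_eq_singleton [Nonempty ι] (h : IsFaceCentre a c) :
    faceLevel a (∏ i, inner ℝ (a i) c) = {c} := by
  ext p
  refine ⟨fun ⟨hp, hpos, hk⟩ => ?_, fun hp => ?_⟩
  · by_contra hne
    exact (h.prod_inner_lt_of_ne hp hpos hne).ne hk
  · rw [mem_singleton_iff.1 hp]
    exact ⟨h.mem_unitSphere, h.pos, rfl⟩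

theorem faceLevel_eq_empty [Nonempty ι] (h : IsFaceCentre a c) {k : ℝ}
    (hk : ∏ i, inner ℝ (a i) c < k) :
    faceLevel a k = ∅ := by
  refine eq_empty_of_forall_notMem fun p ⟨hp, hpos, hpk⟩ => ?_
  by_cases hne : p = c
  · rw [hne] at hpk; exact hk.ne hpk
  · have := h.prod_inner_lt_of_ne hp hpos hne
    linarith

/-- Every direction orthogonal to the centre leaves the cone within a quarter great circle, so
all smaller positive values of the product are attained on the way. -/
theorem exists_mem_faceLevel [Nonempty ι] (h : IsFaceCentre a c) {u : E3} (hu : inner ℝ c u = 0)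
    (hu1 : ‖u‖ = 1) {k : ℝ} (hk0 : 0 < k) (hk : k < ∏ i, inner ℝ (a i) c) :
    ∃ t : ℝ, 0 < sin t ∧ cos t • c + sin t • u ∈ faceLevel a k := by
  -- Truncation at zero keeps negative factors from making the product positive again.
  let G : ℝ → ℝ := fun t => ∏ i, max (inner ℝ (a i) (cos t • c + sin t • u)) 0
  have hG : Continuous G := by
    refine continuous_finsetProd _ fun i _ => ?_
    fun_prop
  have hG0 : G 0 = ∏ i, inner ℝ (a i) c := by
    refine Finset.prod_congr rfl fun i _ => ?_
    simp [(h.pos i).le]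
  have hG1 : G (π / 2) = 0 := by
    obtain ⟨i, hi⟩ : ∃ i, inner ℝ (a i) u ≤ (0 : ℝ) := by
      by_contra! hcon
      exact (Finset.sum_pos (fun i _ => div_pos (hcon i) (h.pos i))
        Finset.univ_nonempty).ne' (h.critical u hu)
    refine Finset.prod_eq_zero (Finset.mem_univ i) ?_
    simpa using hi
  obtain ⟨t, ⟨ht0, ht1⟩, ht⟩ := intermediate_value_Icc' (by positivity : (0 : ℝ) ≤ π / 2)
    hG.continuousOn ⟨hG1.trans_le hk0.le, hk.le.trans_eq hG0.symm⟩
  have htpos : 0 < t := by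
    refine lt_of_le_of_ne ht0 fun h0 => ?_
    rw [← h0, hG0] at ht
    exact hk.ne' ht
  have hpos : ∀ i, 0 < inner ℝ (a i) (cos t • c + sin t • u) := by
    intro i
    by_contra! hi
    refine hk0.ne' (ht.symm.trans (Finset.prod_eq_zero (Finset.mem_univ i) ?_))
    exact max_eq_right hi
  refine ⟨t, sin_pos_of_pos_of_lt_pi htpos (by linarith [Real.pi_pos]), ?_, hpos, ?_⟩
  · rw [Icosahedral.mem_unitSphere, ← sq_eq_sq₀ (norm_nonneg _) zero_le_one,
      h.norm_sq_eq hu, hu1]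
    simp
  · rw [← ht]
    exact Finset.prod_congr rfl fun i _ => (max_eq_left (hpos i).le).symm

theorem isCompact_faceLevel (a : ι → E3) {k : ℝ} (hk0 : 0 < k) : IsCompact (faceLevel a k) := by
  -- For `k > 0` the strict inequalities may be replaced by weak ones, which are closed.
  have : faceLevel a k = unitSphere ∩ ((⋂ i, {p | 0 ≤ inner ℝ (a i) p}) ∩
      {p | ∏ i, inner ℝ (a i) p = k}) := by
    ext p
    simp only [faceLevel, mem_ofPred_eq, mem_inter_iff, mem_iInter]
    refine ⟨fun ⟨h1, h2, h3⟩ => ⟨h1, fun i => (h2 i).le, h3⟩, fun ⟨h1, h2, h3⟩ =>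
      ⟨h1, fun i => lt_of_le_of_ne (h2 i) fun h0 => ?_, h3⟩⟩
    exact hk0.ne (h3 ▸ (Finset.prod_eq_zero (Finset.mem_univ i) h0.symm).symm)
  rw [this]
  refine (isCompact_sphere _ _).inter_right ((isClosed_iInter fun i => ?_).inter ?_)
  · exact isClosed_le continuous_const (by fun_prop)
  · exact isClosed_eq (continuous_finsetProd _ fun i _ => by fun_prop) continuous_const

/-- Below the maximum, central projection from the centre identifies the level curve with the
circle of directions orthogonal to the centre. -/
theorem nonempty_faceLevel_homeomorph_circle [Nonempty ι] (h : IsFaceCentre a c) {k : ℝ}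
    (hk0 : 0 < k) (hk : k < ∏ i, inner ℝ (a i) c) : Nonempty (faceLevel a k ≃ₜ Circle) := by
  obtain ⟨b, hb⟩ := Orthonormal.exists_orthonormalBasis_extension_of_card_eq
    (𝕜 := ℝ) (E := E3) (ι := Fin 3) (by simp) (v := fun _ => c) (s := {0})
    ⟨fun i => by simpa using h.norm_eq, fun i j hij => absurd (Subsingleton.elim i j) hij⟩
  have hb0 : b 0 = c := hb 0 rfl
  have hinner : ∀ i j, inner ℝ (b i) (b j) = if i = j then (1 : ℝ) else 0 :=
    orthonormal_iff_ite.1 b.orthonormal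
  have hc1 : inner ℝ c (b 1) = (0 : ℝ) := by rw [← hb0, hinner]; simp
  have hc2 : inner ℝ c (b 2) = (0 : ℝ) := by rw [← hb0, hinner]; simp
  -- The plane orthogonal to `c` is identified with `ℂ`: `z` is the projection, `w` the inclusion.
  let z : E3 → ℂ := fun p => ⟨inner ℝ (b 1) p, inner ℝ (b 2) p⟩
  let w : ℂ → E3 := fun x => x.re • b 1 + x.im • b 2
  have hz : Continuous z := by
    have : z = fun p => ((inner ℝ (b 1) p : ℝ) : ℂ) + ((inner ℝ (b 2) p : ℝ) : ℂ) * Complex.I := by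
      ext p; exact Complex.mk_eq_add_mul_I _ _
    rw [this]; fun_prop
  have hcw : ∀ x, inner ℝ c (w x) = (0 : ℝ) := fun x => by
    simp [w, inner_add_right, inner_smul_right, hc1, hc2]
  have hw1 : ∀ x, ‖w x‖ = ‖x‖ := fun x => by
    rw [← sq_eq_sq₀ (norm_nonneg _) (norm_nonneg _), ← real_inner_self_eq_norm_sq,
      ← Complex.normSq_eq_norm_sq, Complex.normSq_apply]
    simp only [w, inner_add_right, inner_add_left, inner_smul_right, inner_smul_left, hinner]
    simp
  have hdec : ∀ p, p = inner ℝ c p • c + w (z p) := fun p => by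
    conv_lhs => rw [← b.sum_repr' p, Fin.sum_univ_three, hb0]
    simp [w, z, add_assoc]
  have hdec' : ∀ p, z p ≠ 0 → p = inner ℝ c p • c + ‖z p‖ • w (z p / ‖z p‖) := fun p hp => by
    have hn : ‖z p‖ ≠ 0 := norm_ne_zero_iff.2 hp
    have : ‖z p‖ • w (z p / ‖z p‖) = w (z p) := by
      simp only [w, Complex.div_ofReal_re, Complex.div_ofReal_im, smul_add, smul_smul]
      rw [mul_div_cancel₀ _ hn, mul_div_cancel₀ _ hn]
    rw [this]; exact hdec p
  have hzw : ∀ (α β : ℝ) x, z (α • c + β • w x) = β * x := fun α β x => by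
    rw [← hb0]
    apply Complex.ext <;>
    simp [w, z, inner_add_right, inner_smul_right, hinner]
  have hz0 : ∀ p ∈ faceLevel a k, z p ≠ 0 := by
    rintro p ⟨hp, hpos, hpk⟩ h0
    have hd := hdec p
    rw [h0] at hd
    have hw0 : w 0 = 0 := by simp [w]
    rw [hw0, add_zero] at hd
    have hα : (0 : ℝ) < inner ℝ c p := by
      refine h.coeff_pos (u := (0 : E3)) (β := 0) (by simp) ?_
      simpa [← hd] using hpos
    have hn := congrArg norm hd
    rw [norm_smul, Icosahedral.mem_unitSphere.1 hp, h.norm_eq, Real.norm_of_nonneg hα.le,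
      mul_one] at hn
    rw [← hn, one_smul] at hd
    rw [hd] at hpk
    exact hk.ne' hpk
  have hnormalize : ∀ x : ℂ, x ≠ 0 → ‖x / ‖x‖‖ = 1 := fun x hx => by
    rw [norm_div, Complex.norm_real, norm_norm, div_self (norm_ne_zero_iff.2 hx)]
  -- The direction of a point as seen from the centre.
  let f : faceLevel a k → Circle := fun p =>
    ⟨z p / ‖z p‖, mem_sphere_zero_iff_norm.2 (hnormalize _ (hz0 p p.2))⟩
  have hf : Continuous f := by
    refine Continuous.subtype_mk ?_ _
    have hzp : Continuous fun p : faceLevel a k => z p := hz.comp continuous_subtype_val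
    refine hzp.div (by fun_prop) fun p => ?_
    simpa using hz0 p p.2
  have hne : ∀ p q : faceLevel a k, f p = f q → ¬ ‖z p‖ < ‖z q‖ := by
    intro p q hpq hlt
    have hx : z p / ‖z p‖ = z q / ‖z q‖ := congrArg Subtype.val hpq
    have hp := hdec' p (hz0 p p.2)
    have hq := hdec' q (hz0 q q.2)
    rw [hx] at hp
    set u := w (z q / ‖z q‖)
    have hu : inner ℝ c u = (0 : ℝ) := hcw _
    have hu1 : ‖u‖ = 1 := (hw1 _).trans (hnormalize _ (hz0 q q.2))
    have hsq : ∀ r : faceLevel a k, (r : E3) = inner ℝ c (r : E3) • c + ‖z r‖ • u →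
        (inner ℝ c (r : E3)) ^ 2 + ‖z r‖ ^ 2 = (1 : ℝ) := fun r hr => by
      have := h.norm_sq_eq hu (inner ℝ c (r : E3)) ‖z r‖
      rw [← hr, Icosahedral.mem_unitSphere.1 r.2.1, hu1] at this
      linarith
    have hppos := p.2.2.1
    have hqpos := q.2.2.1
    rw [hp] at hppos
    rw [hq] at hqpos
    have hα := h.coeff_pos hu hppos
    have := h.prod_inner_lt hu (norm_nonneg _) hlt (hsq p hp) (hsq q hq) hα hqpos
    rw [← hp, ← hq, p.2.2.2, q.2.2.2] at this
    exact lt_irrefl _ this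
  have hinj : Function.Injective f := by
    intro p q hpq
    have hnorm : ‖z p‖ = ‖z q‖ :=
      le_antisymm (not_lt.1 (hne q p hpq.symm)) (not_lt.1 (hne p q hpq))
    have hx : z p / ‖z p‖ = z q / ‖z q‖ := congrArg Subtype.val hpq
    have hzz : z p = z q := by
      rw [hnorm] at hx
      exact (div_left_inj' (by simpa using hz0 q q.2)).1 hx
    have hα : ∀ r : faceLevel a k, 0 < inner ℝ c (r : E3) := fun r => by
      have hr := r.2.2.1
      rw [hdec r, ← one_smul ℝ (w (z r))] at hr
      exact h.coeff_pos (hcw _) hr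
    have hsq : ∀ r : faceLevel a k, (inner ℝ c (r : E3)) ^ 2 + ‖z r‖ ^ 2 = (1 : ℝ) := fun r => by
      have := h.norm_sq_eq (hcw (z r)) (inner ℝ c (r : E3)) 1
      rw [one_smul, ← hdec r, Icosahedral.mem_unitSphere.1 r.2.1, hw1] at this
      linarith
    have hcc : inner ℝ c (p : E3) = inner ℝ c (q : E3) := by
      have h1 := hsq p
      have h2 := hsq q
      rw [hzz] at h1
      exact (sq_eq_sq₀ (hα p).le (hα q).le).1 (by linarith)
    apply Subtype.ext
    rw [hdec p, hdec q, hcc, hzz]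
  have hsurj : Function.Surjective f := by
    intro x
    obtain ⟨t, ht, hmem⟩ := h.exists_mem_faceLevel (hcw x)
      ((hw1 x).trans (Circle.norm_coe x)) hk0 hk
    refine ⟨⟨_, hmem⟩, Subtype.ext ?_⟩
    change z _ / (‖z _‖ : ℂ) = x
    rw [hzw, norm_mul, Circle.norm_coe, Complex.norm_real, Real.norm_of_nonneg ht.le, mul_one]
    have : (sin t : ℂ) ≠ 0 := by exact_mod_cast ht.ne'
    exact mul_div_cancel_left₀ _ (by exact_mod_cast ht.ne')
  have : CompactSpace (faceLevel a k) := isCompact_iff_compactSpace.1 (isCompact_faceLevel a hk0)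
  exact ⟨Continuous.homeoOfEquivCompactToT2 (f := Equiv.ofBijective f ⟨hinj, hsurj⟩) hf⟩

end IsFaceCentre

/-! ### The six axes and the sign vectors of the faces -/

/-- Vectors along the six axes of the icosahedron; they are the normals of the six planes that
make up the surface `V = 0`. -/
def axis : Fin 6 → E3 :=
  ![!₂[goldenRatio, -1, 0], !₂[goldenRatio, 1, 0], !₂[0, goldenRatio, -1],
    !₂[0, goldenRatio, 1], !₂[-1, 0, goldenRatio], !₂[1, 0, goldenRatio]]

/-- The signs of the off-diagonal inner products of the six axes (a conference matrix). -/
def axisSign : Fin 6 → Fin 6 → ℤ :=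
  ![![0, 1, -1, -1, -1, 1], ![1, 0, 1, 1, -1, 1], ![-1, 1, 0, 1, -1, -1],
    ![-1, 1, 1, 0, 1, 1], ![-1, -1, -1, 1, 0, 1], ![1, 1, -1, 1, 1, 0]]

theorem goldenRatio_eq : goldenRatio = (1 + √5) / 2 := rfl

theorem sqrt_five_sq : √5 ^ 2 = (5 : ℝ) := Real.sq_sqrt (by norm_num)

theorem goldenRatio_cubed : goldenRatio ^ 3 = 2 + √5 := by
  rw [goldenRatio_eq]; linear_combination (3 + √5) / 8 * sqrt_five_sq

theorem sqrt_five_eq : √5 = 2 * goldenRatio - 1 := by rw [goldenRatio_eq]; ring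

theorem inner_eq (p q : E3) : inner ℝ p q = p 0 * q 0 + p 1 * q 1 + p 2 * q 2 := by
  simp [PiLp.inner_apply, Fin.sum_univ_three, mul_comm]

theorem inner_axis_axis (i j : Fin 6) : inner ℝ (axis i) (axis j) =
    goldenRatio * ((if i = j then √5 else 0) + axisSign i j) := by
  rw [inner_eq, sqrt_five_eq]
  have := goldenRatio_sq
  fin_cases i <;> fin_cases j <;> simp [axis, axisSign] <;> linarith

theorem sum_axisSign_smul_axis (i : Fin 6) :
    ∑ j, (axisSign i j : ℝ) • axis j = √5 • axis i := by
  ext k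
  fin_cases i <;> fin_cases k <;> simp [axis, axisSign, Fin.sum_univ_succ] <;>
    first | ring1 | linear_combination -(1 / 2) * sqrt_five_sq

theorem V_eq_prod_inner (p : E3) : V p = ∏ i, inner ℝ (axis i) p := by
  simp [inner_eq, Fin.prod_univ_six, axis]
  unfold V
  ring

theorem axisSign_comm (i j : Fin 6) : axisSign i j = axisSign j i := by
  revert i j; decide

/-- The vectors `± axis i` with signs `s`. -/
def signedAxis (s : Fin 6 → ℤˣ) (i : Fin 6) : E3 := ((s i : ℤ) : ℝ) • axis i

theorem inner_signedAxis (s : Fin 6 → ℤˣ) (i : Fin 6) (p : E3) :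
    inner ℝ (signedAxis s i) p = ((s i : ℤ) : ℝ) * inner ℝ (axis i) p := by
  simp [signedAxis, inner_smul_left]

theorem sign_mul_self (u : ℤˣ) : ((u : ℤ) : ℝ) * ((u : ℤ) : ℝ) = 1 := by
  rcases Int.units_eq_one_or u with h | h <;> simp [h]

theorem prod_inner_signedAxis (s : Fin 6 → ℤˣ) (p : E3) :
    ∏ i, inner ℝ (signedAxis s i) p = (((∏ i, s i : ℤˣ) : ℤ) : ℝ) * V p := by
  rw [V_eq_prod_inner]
  simp_rw [inner_signedAxis, Finset.prod_mul_distrib]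
  push_cast
  rfl

/-- The row sums of the matrix `s i * axisSign i j * s j`. -/
def rowSum (s : Fin 6 → ℤˣ) (i : Fin 6) : ℤ := ∑ j, s i * axisSign i j * s j

/-- The sign vectors of the twelve pentagonal faces of the icosidodecahedron, described by their
row sums; `k` is the axis through the centre of the face. -/
def pentagons : Finset (Fin 6 → ℤˣ) :=
  {s | ∃ k, ∀ i, rowSum s i = if i = k then 5 else 1}

/-- The sign vectors of the twenty triangular faces of the icosidodecahedron, described by their
row sums. -/
def triangles : Finset (Fin 6 → ℤˣ) :=
  {s | (∀ i, rowSum s i = 3 ∨ rowSum s i = -1) ∧ ∏ i, s i = 1 ∧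
    (Finset.univ.filter fun i => rowSum s i = 3).card = 3}

theorem card_pentagons : pentagons.card = 12 := by decide +kernel

theorem card_triangles : triangles.card = 20 := by decide +kernel

theorem prod_eq_of_mem_pentagons : ∀ s ∈ pentagons, ∏ i, s i = -1 := by decide +kernel

/-- Every sign vector that is not that of a face has all its row sums at most `1`. -/
theorem rowSum_le_or_mem : ∀ s : Fin 6 → ℤˣ,
    (∀ i, rowSum s i ≤ 1) ∨ s ∈ pentagons ∨ s ∈ triangles := by decide +kernel

theorem cast_rowSum (s : Fin 6 → ℤˣ) (i : Fin 6) : (rowSum s i : ℝ) =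
    ((s i : ℤ) : ℝ) * ∑ j, (axisSign i j : ℝ) * ((s j : ℤ) : ℝ) := by
  simp [rowSum, Finset.mul_sum, mul_assoc]

/-- The vector `∑ i, s i • axis i`, which spans the symmetry axis of the face with sign
vector `s`. -/
def faceAxis (s : Fin 6 → ℤˣ) : E3 := ∑ i, signedAxis s i

theorem inner_signedAxis_faceAxis (s : Fin 6 → ℤˣ) (i : Fin 6) :
    inner ℝ (signedAxis s i) (faceAxis s) = goldenRatio * (√5 + rowSum s i) := by
  rw [inner_signedAxis, faceAxis, inner_sum, cast_rowSum]
  have : ∀ j, inner ℝ (axis i) (signedAxis s j) = goldenRatio *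
      ((if i = j then √5 * ((s j : ℤ) : ℝ) else 0) + axisSign i j * ((s j : ℤ) : ℝ)) := fun j => by
    rw [real_inner_comm, inner_signedAxis, real_inner_comm, inner_axis_axis]
    split_ifs <;> ring
  simp_rw [this, ← Finset.mul_sum, Finset.sum_add_distrib, Finset.sum_ite_eq, Finset.mem_univ,
    if_true]
  linear_combination goldenRatio * √5 * sign_mul_self (s i)

/-- The eigenvector relation of `axisSign`, applied to a sign vector. -/
theorem sum_rowSum_mul_inner (s : Fin 6 → ℤˣ) (p : E3) :
    ∑ i, (rowSum s i : ℝ) * inner ℝ (signedAxis s i) p =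
      √5 * ∑ i, inner ℝ (signedAxis s i) p := by
  have h1 : ∀ i, (rowSum s i : ℝ) * inner ℝ (signedAxis s i) p =
      ∑ j, ((s j : ℤ) : ℝ) * ((axisSign j i : ℝ) * inner ℝ (axis i) p) := fun i => by
    rw [inner_signedAxis, cast_rowSum, mul_mul_mul_comm, sign_mul_self, one_mul,
      Finset.sum_mul]
    refine Finset.sum_congr rfl fun j _ => ?_
    rw [axisSign_comm i j]; ring
  have h2 : ∀ j, ∑ i, (axisSign j i : ℝ) * inner ℝ (axis i) p = √5 * inner ℝ (axis j) p :=
    fun j => by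
      have := congrArg (fun q => inner ℝ q p) (sum_axisSign_smul_axis j)
      simpa [sum_inner, inner_smul_left] using this
  simp_rw [h1]
  rw [Finset.sum_comm]
  simp_rw [← Finset.mul_sum, h2, inner_signedAxis, Finset.mul_sum]
  exact Finset.sum_congr rfl fun j _ => by ring

/-- A sign vector that is realized on the sphere is that of a face of the icosidodecahedron: for
the others, `sum_rowSum_mul_inner` is a vanishing positive combination of the six forms. -/
theorem mem_pentagons_or_mem_triangles {s : Fin 6 → ℤˣ} {p : E3}
    (h : ∀ i, 0 < inner ℝ (signedAxis s i) p) : s ∈ pentagons ∨ s ∈ triangles := by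
  refine (rowSum_le_or_mem s).resolve_left fun hle => ?_
  have h5 : (1 : ℝ) < √5 := Real.lt_sqrt_of_sq_lt (by norm_num)
  have hpos : 0 < ∑ i, (√5 - rowSum s i) * inner ℝ (signedAxis s i) p := by
    refine Finset.sum_pos (fun i _ => mul_pos ?_ (h i)) Finset.univ_nonempty
    have : (rowSum s i : ℝ) ≤ 1 := by exact_mod_cast hle i
    linarith
  simp_rw [sub_mul, Finset.sum_sub_distrib, ← Finset.mul_sum, sum_rowSum_mul_inner] at hpos
  simp at hpos

theorem norm_faceAxis_sq (s : Fin 6 → ℤˣ) :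
    ‖faceAxis s‖ ^ 2 = goldenRatio * (6 * √5 + ∑ i, (rowSum s i : ℝ)) := by
  have : ‖faceAxis s‖ ^ 2 = ∑ i, inner ℝ (signedAxis s i) (faceAxis s) := by
    rw [← real_inner_self_eq_norm_sq, ← sum_inner]; rfl
  simp_rw [this, inner_signedAxis_faceAxis, ← Finset.mul_sum, Finset.sum_add_distrib]
  simp

/-- The unit vector in the direction of `faceAxis s`. -/
def faceCentre (s : Fin 6 → ℤˣ) : E3 := ‖faceAxis s‖⁻¹ • faceAxis s

/-- If the row sums of `s` take only two values, then `1 / (√5 + rowSum s i)` is an affine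
function of `rowSum s i`, and so `sum_rowSum_mul_inner` gives the critical point equation. -/
theorem isFaceCentre_faceCentre {s : Fin 6 → ℤˣ} {x y : ℝ} (hx : 0 < √5 + x) (hy : 0 < √5 + y)
    (h : ∀ i, (rowSum s i : ℝ) = x ∨ (rowSum s i : ℝ) = y) :
    IsFaceCentre (signedAxis s) (faceCentre s) := by
  have hpos : ∀ i, 0 < √5 + (rowSum s i : ℝ) := fun i => by
    rcases h i with h | h <;> rwa [h]
  have hφ := goldenRatio_pos
  have hne : 0 < ‖faceAxis s‖ := by
    refine norm_pos_iff.2 fun h0 => ?_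
    have := inner_signedAxis_faceAxis s 0
    rw [h0, inner_zero_right] at this
    exact (mul_pos hφ (hpos 0)).ne this
  refine ⟨?_, fun i => ?_, fun u hu => ?_⟩
  · rw [faceCentre, norm_smul, norm_inv, norm_norm, inv_mul_cancel₀ hne.ne']
  · rw [faceCentre, inner_smul_right, inner_signedAxis_faceAxis]
    have := hpos i
    positivity
  · have hu' : ∑ i, inner ℝ (signedAxis s i) u = 0 := by
      rw [faceCentre, inner_smul_left] at hu
      rw [← sum_inner]
      exact (mul_eq_zero.1 hu).resolve_left (by simpa using hne.ne')
    have hterm : ∀ i, inner ℝ (signedAxis s i) u / inner ℝ (signedAxis s i) (faceCentre s) =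
        ‖faceAxis s‖ / (goldenRatio * ((√5 + x) * (√5 + y))) *
          ((√5 + x + y) * inner ℝ (signedAxis s i) u
            - (rowSum s i : ℝ) * inner ℝ (signedAxis s i) u) := fun i => by
      have h1 := hpos i
      rw [faceCentre, inner_smul_right, inner_signedAxis_faceAxis]
      field_simp
      rcases h i with h | h <;> rw [h] <;> ring
    simp_rw [hterm, ← Finset.mul_sum, Finset.sum_sub_distrib, ← Finset.mul_sum,
      sum_rowSum_mul_inner, hu']
    simp

theorem prod_inner_faceCentre (s : Fin 6 → ℤˣ) :
    ∏ i, inner ℝ (signedAxis s i) (faceCentre s) =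
      goldenRatio ^ 6 * (∏ i, (√5 + (rowSum s i : ℝ))) / (‖faceAxis s‖ ^ 2) ^ 3 := by
  have : ∀ i, inner ℝ (signedAxis s i) (faceCentre s) =
      ‖faceAxis s‖⁻¹ * (goldenRatio * (√5 + rowSum s i)) := fun i => by
    rw [faceCentre, inner_smul_right, inner_signedAxis_faceAxis]
  simp_rw [this, Finset.prod_mul_distrib]
  simp [← pow_mul]
  ring

theorem isFaceCentre_of_mem_pentagons {s : Fin 6 → ℤˣ} (hs : s ∈ pentagons) :
    IsFaceCentre (signedAxis s) (faceCentre s) ∧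
      ∏ i, inner ℝ (signedAxis s i) (faceCentre s) = (2 + √5) / 5 := by
  obtain ⟨k, hk⟩ := (Finset.mem_filter.1 hs).2
  have hk' : ∀ i, (rowSum s i : ℝ) = if i = k then 5 else 1 := fun i => by
    rw [hk i]; split_ifs <;> norm_num
  refine ⟨isFaceCentre_faceCentre (x := 5) (y := 1) (by positivity) (by positivity) fun i => ?_, ?_⟩
  · rw [hk' i]; split_ifs <;> simp
  · have h1 : ∑ i, (rowSum s i : ℝ) = 10 := by
      simp_rw [hk', Finset.sum_ite, Finset.sum_const, Finset.filter_eq', Finset.filter_ne']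
      norm_num
    have h2 : ∏ i, (√5 + (rowSum s i : ℝ)) = (√5 + 5) * (√5 + 1) ^ 5 := by
      have : ∀ i, √5 + (rowSum s i : ℝ) = if i = k then √5 + 5 else √5 + 1 := fun i => by
        rw [hk' i]; split_ifs <;> rfl
      simp_rw [this, Finset.prod_ite, Finset.prod_const, Finset.filter_eq', Finset.filter_ne']
      simp
    rw [prod_inner_faceCentre, norm_faceAxis_sq, h1, h2]
    have hφ := goldenRatio_pos
    have : (0 : ℝ) < 6 * √5 + 10 := by positivity
    field_simp
    -- The coefficient is the quotient of the difference of the two sides by `√5 ^ 2 - 5`.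
    linear_combination (3195 + 7319 * √5 + 6827 * √5 ^ 2 + 3575 * √5 ^ 3 +
      1305 * √5 ^ 4 + 365 * √5 ^ 5 + 65 * √5 ^ 6 + 5 * √5 ^ 7) * sqrt_five_sq

theorem isFaceCentre_of_mem_triangles {s : Fin 6 → ℤˣ} (hs : s ∈ triangles) :
    IsFaceCentre (signedAxis s) (faceCentre s) ∧
      ∏ i, inner ℝ (signedAxis s i) (faceCentre s) = (2 + √5) / 27 := by
  obtain ⟨hk, -, hcard⟩ := (Finset.mem_filter.1 hs).2
  have hk' : ∀ i, (rowSum s i : ℝ) = if rowSum s i = 3 then 3 else -1 := fun i => by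
    rcases hk i with h | h <;> simp [h]
  have hcard' : (Finset.univ.filter fun i => ¬ rowSum s i = 3).card = 3 := by
    have := Finset.card_filter_add_card_filter_not (s := Finset.univ) fun i => rowSum s i = 3
    simp only [hcard, Finset.card_univ, Fintype.card_fin] at this
    omega
  have h51 : (1 : ℝ) < √5 := Real.lt_sqrt_of_sq_lt (by norm_num)
  refine ⟨isFaceCentre_faceCentre (x := 3) (y := -1) (by positivity) (by linarith) fun i => ?_, ?_⟩
  · rw [hk' i]; split_ifs <;> simp
  · have h1 : ∑ i, (rowSum s i : ℝ) = 6 := by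
      simp_rw [hk', Finset.sum_ite, Finset.sum_const, hcard, hcard']
      norm_num
    have h2 : ∏ i, (√5 + (rowSum s i : ℝ)) = (√5 + 3) ^ 3 * (√5 - 1) ^ 3 := by
      have : ∀ i, √5 + (rowSum s i : ℝ) = if rowSum s i = 3 then √5 + 3 else √5 - 1 :=
        fun i => by rcases hk i with h | h <;> simp [h]; ring
      simp_rw [this, Finset.prod_ite, Finset.prod_const, hcard, hcard']
    rw [prod_inner_faceCentre, norm_faceAxis_sq, h1, h2]
    have hφ := goldenRatio_pos
    have : (0 : ℝ) < 6 * √5 + 6 := by positivity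
    field_simp
    -- The coefficient is the quotient of the difference of the two sides by `√5 ^ 2 - 5`.
    linear_combination (837 + 2565 * √5 + 2889 * √5 ^ 2 + 1809 * √5 ^ 3 +
      1215 * √5 ^ 4 + 783 * √5 ^ 5 + 243 * √5 ^ 6 + 27 * √5 ^ 7) * sqrt_five_sq

/-! ### The level sets of `V` on the faces -/

theorem prod_eq_of_mem_triangles {s : Fin 6 → ℤˣ} (hs : s ∈ triangles) : ∏ i, s i = 1 :=
  (Finset.mem_filter.1 hs).2.2.1

theorem exists_signs {p : E3} (hp : V p ≠ 0) :
    ∃ s : Fin 6 → ℤˣ, ∀ i, 0 < inner ℝ (signedAxis s i) p := by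
  rw [V_eq_prod_inner, Finset.prod_ne_zero_iff] at hp
  refine ⟨fun i => if 0 < inner ℝ (axis i) p then 1 else -1, fun i => ?_⟩
  rw [inner_signedAxis]
  split_ifs with h
  · simpa using h
  · have := lt_of_le_of_ne (not_lt.1 h) (hp i (Finset.mem_univ i))
    simpa using this

theorem eq_of_inner_signedAxis_pos {s t : Fin 6 → ℤˣ} {p : E3}
    (hs : ∀ i, 0 < inner ℝ (signedAxis s i) p) (ht : ∀ i, 0 < inner ℝ (signedAxis t i) p) :
    s = t := by
  funext i
  have h1 := hs i
  have h2 := ht i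
  rw [inner_signedAxis] at h1 h2
  rcases Int.units_eq_one_or (s i) with h | h <;> rcases Int.units_eq_one_or (t i) with h' | h' <;>
    simp only [h, h', Units.val_one, Units.val_neg, Int.cast_one, Int.cast_neg] at h1 h2 ⊢ <;>
    linarith

/-- All faces on which `V` has the sign `η`, together with their centres and the common extreme
value `K` of `|V|` on them. -/
structure IsFaceFamily (𝒢 : Finset (Fin 6 → ℤˣ)) (η : ℤˣ) (K : ℝ) : Prop where
  prod_eq : ∀ s ∈ 𝒢, ∏ i, s i = η
  mem_of_prod_eq : ∀ {s : Fin 6 → ℤˣ} {p : E3}, (∀ i, 0 < inner ℝ (signedAxis s i) p) →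
    ∏ i, s i = η → s ∈ 𝒢
  isFaceCentre : ∀ s ∈ 𝒢, IsFaceCentre (signedAxis s) (faceCentre s)
  prod_inner : ∀ s ∈ 𝒢, ∏ i, inner ℝ (signedAxis s i) (faceCentre s) = K

theorem isFaceFamily_pentagons : IsFaceFamily pentagons (-1) ((2 + √5) / 5) where
  prod_eq := prod_eq_of_mem_pentagons
  mem_of_prod_eq hp h := (mem_pentagons_or_mem_triangles hp).resolve_right fun hs => by
    rw [prod_eq_of_mem_triangles hs] at h
    exact absurd h (by decide)
  isFaceCentre _ hs := (isFaceCentre_of_mem_pentagons hs).1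
  prod_inner _ hs := (isFaceCentre_of_mem_pentagons hs).2

theorem isFaceFamily_triangles : IsFaceFamily triangles 1 ((2 + √5) / 27) where
  prod_eq _ hs := prod_eq_of_mem_triangles hs
  mem_of_prod_eq hp h := (mem_pentagons_or_mem_triangles hp).resolve_left fun hs => by
    rw [prod_eq_of_mem_pentagons _ hs] at h
    exact absurd h (by decide)
  isFaceCentre _ hs := (isFaceCentre_of_mem_triangles hs).1
  prod_inner _ hs := (isFaceCentre_of_mem_triangles hs).2

namespace IsFaceFamily

variable {𝒢 : Finset (Fin 6 → ℤˣ)} {η : ℤˣ} {K : ℝ}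

theorem unitSphere_inter_surfaceT (h : IsFaceFamily 𝒢 η K) {k : ℝ} (hk : 0 < k) :
    unitSphere ∩ surfaceT ((η : ℤ) * k) = ⋃ s : 𝒢, faceLevel (signedAxis s) k := by
  ext p
  simp only [mem_inter_iff, mem_iUnion, faceLevel, surfaceT, mem_ofPred_eq, prod_inner_signedAxis]
  constructor
  · rintro ⟨hp, hV⟩
    have hη : ((η : ℤ) : ℝ) ≠ 0 := by exact_mod_cast η.ne_zero
    obtain ⟨s, hs⟩ := exists_signs (p := p) (by rw [hV]; exact mul_ne_zero hη hk.ne')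
    have hprod : ∏ i, s i = η := by
      have hpos := Finset.prod_pos fun i (_ : i ∈ Finset.univ) => hs i
      rw [prod_inner_signedAxis, hV] at hpos
      rcases Int.units_eq_one_or (∏ i, s i) with h | h <;>
        rcases Int.units_eq_one_or η with h' | h' <;> rw [h, h'] at hpos ⊢ <;>
        norm_num at hpos <;> linarith
    refine ⟨⟨s, h.mem_of_prod_eq hs hprod⟩, hp, hs, ?_⟩
    rw [hV, hprod, ← mul_assoc, sign_mul_self, one_mul]
  · rintro ⟨⟨s, hs⟩, hp, -, hV⟩
    refine ⟨hp, ?_⟩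
    rw [h.prod_eq s hs] at hV
    rw [← hV, ← mul_assoc, sign_mul_self, one_mul]

theorem inter_eq_empty (h : IsFaceFamily 𝒢 η K) (hK : 0 < K) {k : ℝ} (hk : K < k) :
    unitSphere ∩ surfaceT ((η : ℤ) * k) = ∅ := by
  rw [h.unitSphere_inter_surfaceT (hK.trans hk)]
  exact iUnion_eq_empty.2 fun s =>
    (h.isFaceCentre s s.2).faceLevel_eq_empty ((h.prod_inner s s.2).trans_lt hk)

theorem consistsOfIsolatedPoints (h : IsFaceFamily 𝒢 η K) (hK : 0 < K) :
    ConsistsOfIsolatedPoints 𝒢.card (unitSphere ∩ surfaceT ((η : ℤ) * K)) := by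
  have heq : unitSphere ∩ surfaceT ((η : ℤ) * K) = faceCentre '' (𝒢 : Set (Fin 6 → ℤˣ)) := by
    rw [h.unitSphere_inter_surfaceT hK, image_eq_iUnion, iUnion_subtype]
    refine iUnion₂_congr fun s hs => ?_
    rw [← h.prod_inner s hs, (h.isFaceCentre s hs).faceLevel_eq_singleton]
  have hinj : InjOn faceCentre (𝒢 : Set (Fin 6 → ℤˣ)) := fun s hs t ht hst =>
    eq_of_inner_signedAxis_pos (h.isFaceCentre s hs).pos (hst ▸ (h.isFaceCentre t ht).pos)
  rw [heq]
  refine ⟨?_, ?_⟩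
  · rw [hinj.encard_image, encard_coe_eq_coe_finsetCard]
  · have := (𝒢.finite_toSet.image faceCentre).to_subtype
    infer_instance

theorem consistsOfDisjointCircles (h : IsFaceFamily 𝒢 η K) {k : ℝ} (hk0 : 0 < k) (hk : k < K) :
    ConsistsOfDisjointCircles 𝒢.card (unitSphere ∩ surfaceT ((η : ℤ) * k)) := by
  refine ⟨fun i => faceLevel (signedAxis (𝒢.equivFin.symm i)) k, fun i => ?_, fun i j hij => ?_, ?_⟩
  · have hi := (𝒢.equivFin.symm i).2
    exact (h.isFaceCentre _ hi).nonempty_faceLevel_homeomorph_circle hk0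
      (hk.trans_eq (h.prod_inner _ hi).symm)
  · refine Set.disjoint_left.2 fun p hp hq => hij ?_
    exact 𝒢.equivFin.symm.injective (Subtype.ext (eq_of_inner_signedAxis_pos hp.2.1 hq.2.1))
  · rw [h.unitSphere_inter_surfaceT hk0]
    exact (𝒢.equivFin.symm.surjective.iUnion_comp fun s : 𝒢 => faceLevel (signedAxis s) k).symm

end IsFaceFamily

/-! ### The six great circles -/

/-- The cyclic permutations of the coordinates. -/
def rot (j : Fin 3) : E3 ≃ₗᵢ[ℝ] E3 := LinearIsometryEquiv.piLpCongrLeft 2 ℝ ℝ (Equiv.subRight j)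

@[simp]
theorem rot_apply (j : Fin 3) (p : E3) (k : Fin 3) : rot j p k = p (k + j) := by
  simp [rot, LinearIsometryEquiv.piLpCongrLeft_apply, Equiv.piCongrLeft'_apply]

theorem isFixedPoint_iff (p : E3) : IsFixedPoint p ↔
    ∀ k : Fin 3, fieldComponent (p k) (p (k + 1)) (p (k + 2)) = 0 := by
  rw [IsFixedPoint, PiLp.ext_iff]
  simp [vectorField, Fin.forall_fin_succ]

theorem isFixedPoint_rot (j : Fin 3) (p : E3) : IsFixedPoint (rot j p) ↔ IsFixedPoint p := by
  simp only [isFixedPoint_iff, rot_apply]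
  rw [← (Equiv.addRight j).forall_congr_right
    (q := fun k => fieldComponent (p k) (p (k + 1)) (p (k + 2)) = 0)]
  simp only [Equiv.coe_addRight, add_right_comm]

/-- The linear form whose kernel is the plane of the great circle `circlePoint (j, ε)`. -/
def planeForm (i : Fin 3 × ℤˣ) (p : E3) : ℝ :=
  ((i.2 : ℤ) : ℝ) * goldenRatio * p (-i.1) - p (1 - i.1)

theorem exists_planeForm_eq_zero {p : E3} (h : V p = 0) : ∃ i, planeForm i p = 0 := by
  have key : ∀ j : Fin 3, goldenRatio ^ 2 * p (-j) ^ 2 - p (1 - j) ^ 2 = 0 →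
      ∃ i, planeForm i p = 0 := fun j hj => by
    have hj' : (goldenRatio * p (-j) + p (1 - j)) * (goldenRatio * p (-j) - p (1 - j)) = 0 := by
      linear_combination hj
    rcases mul_eq_zero.1 hj' with h | h
    · refine ⟨(j, -1), ?_⟩
      simp [planeForm]; linarith
    · refine ⟨(j, 1), ?_⟩
      simp [planeForm]; linarith
  rw [V, mul_eq_zero, mul_eq_zero] at h
  rcases h with (h | h) | h
  · exact key 0 h
  · exact key 2 h
  · exact key 1 h

theorem planeForm_rot (j : Fin 3) (i : Fin 3 × ℤˣ) (p : E3) :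
    planeForm i (rot j p) = planeForm (i.1 - j, i.2) p := by
  simp only [planeForm, rot_apply, neg_sub, sub_sub_eq_add_sub]
  rw [neg_add_eq_sub, sub_add_eq_add_sub]

/-- The length of the vectors `axis i`. -/
def axisNorm : ℝ := √(1 + goldenRatio ^ 2)

theorem axisNorm_sq : axisNorm ^ 2 = 1 + goldenRatio ^ 2 := Real.sq_sqrt (by positivity)

theorem axisNorm_pos : 0 < axisNorm := Real.sqrt_pos.2 (by positivity)

/-- Arc length parametrization of the great circle in the plane `y = ε φ x`, starting at the
point `(0, 0, 1)`. -/
def baseCircle (ε : ℤˣ) (θ : ℝ) : E3 :=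
  !₂[sin θ / axisNorm, ((ε : ℤ) : ℝ) * goldenRatio * (sin θ / axisNorm), cos θ]

/-- Arc length parametrizations of the six great circles that make up `V = 0`. -/
def circlePoint (i : Fin 3 × ℤˣ) (θ : ℝ) : E3 := rot i.1 (baseCircle i.2 θ)

theorem inner_baseCircle (ε : ℤˣ) (θ η : ℝ) :
    inner ℝ (baseCircle ε θ) (baseCircle ε η) = cos (θ - η) := by
  have hn := axisNorm_pos.ne'
  rw [inner_eq, cos_sub]
  simp only [baseCircle]
  simp
  field_simp
  have hε : ((ε : ℤ) : ℝ) ^ 2 = 1 := by rw [sq, sign_mul_self]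
  rw [axisNorm_sq, hε]
  ring

theorem inner_circlePoint (i : Fin 3 × ℤˣ) (θ η : ℝ) :
    inner ℝ (circlePoint i θ) (circlePoint i η) = cos (θ - η) := by
  rw [circlePoint, circlePoint, LinearIsometryEquiv.inner_map_map, inner_baseCircle]

theorem norm_circlePoint (i : Fin 3 × ℤˣ) (θ : ℝ) : ‖circlePoint i θ‖ = 1 := by
  rw [← sq_eq_sq₀ (norm_nonneg _) zero_le_one, ← real_inner_self_eq_norm_sq, inner_circlePoint]
  simp

theorem cos_smul_baseCircle_add (ε : ℤˣ) (θ t : ℝ) :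
    cos t • baseCircle ε θ + sin t • baseCircle ε (θ + π / 2) = baseCircle ε (θ + t) := by
  ext k
  fin_cases k <;> simp [baseCircle, sin_add, cos_add] <;> ring

theorem cos_smul_circlePoint_add (i : Fin 3 × ℤˣ) (θ t : ℝ) :
    cos t • circlePoint i θ + sin t • circlePoint i (θ + π / 2) = circlePoint i (θ + t) := by
  rw [circlePoint, circlePoint, circlePoint, ← cos_smul_baseCircle_add i.2 θ t, map_add, map_smul,
    map_smul]

theorem planeForm_circlePoint (i : Fin 3 × ℤˣ) (θ : ℝ) : planeForm i (circlePoint i θ) = 0 := by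
  rw [circlePoint, planeForm_rot]
  simp [planeForm, baseCircle]

theorem V_eq_zero_of_planeForm_eq_zero {i : Fin 3 × ℤˣ} {p : E3} (h : planeForm i p = 0) :
    V p = 0 := by
  have h2 : goldenRatio ^ 2 * p (-i.1) ^ 2 - p (1 - i.1) ^ 2 = 0 := by
    have h1 : ((i.2 : ℤ) : ℝ) * goldenRatio * p (-i.1) = p (1 - i.1) := sub_eq_zero.1 h
    rw [← h1]
    linear_combination -goldenRatio ^ 2 * p (-i.1) ^ 2 * sign_mul_self i.2
  obtain ⟨j, ε⟩ := i
  rw [V, mul_eq_zero, mul_eq_zero]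
  fin_cases j
  · exact Or.inl (Or.inl (by simpa using h2))
  · exact Or.inr h2
  · exact Or.inl (Or.inr h2)

theorem exists_angle {x y : ℝ} (h : x ^ 2 + y ^ 2 = 1) :
    ∃ θ, 0 ≤ θ ∧ θ < 2 * π ∧ cos θ = x ∧ sin θ = y := by
  have hz : ‖(⟨x, y⟩ : ℂ)‖ = 1 := by
    rw [← sq_eq_sq₀ (norm_nonneg _) zero_le_one, ← Complex.normSq_eq_norm_sq,
      Complex.normSq_apply]
    simp; linarith
  have hc := Complex.norm_mul_cos_arg ⟨x, y⟩
  have hs := Complex.norm_mul_sin_arg ⟨x, y⟩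
  rw [hz, one_mul] at hc hs
  have h1 := Complex.neg_pi_lt_arg ⟨x, y⟩
  have h2 := Complex.arg_le_pi ⟨x, y⟩
  rcases le_or_gt 0 (Complex.arg ⟨x, y⟩) with h0 | h0
  · exact ⟨_, h0, by linarith [Real.pi_pos], hc, hs⟩
  · exact ⟨_, by linarith, by linarith, (cos_add_two_pi _).trans hc, (sin_add_two_pi _).trans hs⟩

theorem exists_circlePoint_eq {p : E3} (hp : p ∈ unitSphere) {i : Fin 3 × ℤˣ}
    (h : planeForm i p = 0) : ∃ θ, 0 ≤ θ ∧ θ < 2 * π ∧ circlePoint i θ = p := by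
  obtain ⟨q, rfl⟩ := (rot i.1).surjective p
  rw [mem_unitSphere, LinearIsometryEquiv.norm_map] at hp
  rw [planeForm_rot] at h
  have h1 : q 1 = ((i.2 : ℤ) : ℝ) * goldenRatio * q 0 := by
    simp [planeForm] at h; linarith
  have hq : q 2 ^ 2 + (axisNorm * q 0) ^ 2 = 1 := by
    have hqq : inner ℝ q q = (1 : ℝ) := by rw [real_inner_self_eq_norm_sq, hp]; norm_num
    rw [inner_eq, h1] at hqq
    rw [mul_pow, axisNorm_sq]
    linear_combination hqq - goldenRatio ^ 2 * q 0 ^ 2 * sign_mul_self i.2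
  obtain ⟨θ, h0, h2, hc, hs⟩ := exists_angle hq
  refine ⟨θ, h0, h2, ?_⟩
  rw [circlePoint]
  congr 1
  have hn := axisNorm_pos.ne'
  ext k
  fin_cases k <;> simp [baseCircle, hc, hs, h1, mul_div_cancel_left₀ _ hn]

theorem sin_five_mul (θ : ℝ) : sin (5 * θ) = sin θ * (16 * sin θ ^ 4 - 20 * sin θ ^ 2 + 5) := by
  have h : 5 * θ = 2 * θ + 3 * θ := by ring
  rw [h, sin_add, sin_two_mul, cos_two_mul, sin_three_mul, cos_three_mul]
  have := sin_sq_add_cos_sq θ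
  have h2 : cos θ ^ 2 = 1 - sin θ ^ 2 := by linarith
  have h4 : cos θ ^ 4 = (1 - sin θ ^ 2) ^ 2 := by rw [← h2]; ring
  ring_nf
  rw [h4, h2]
  ring

/-- The product of the five forms that do not vanish identically on the great circle in the plane
`y = ε φ x`, up to a constant factor. -/
def otherForms (x z : ℝ) : ℝ :=
  x * (goldenRatio ^ 4 * x ^ 2 - z ^ 2) * (goldenRatio ^ 2 * z ^ 2 - x ^ 2)

/-- On the great circle, the other five forms vanish at the ten points that divide it into equal
arcs. -/
theorem goldenRatio_sq_mul_sin_five_mul (θ : ℝ) : goldenRatio ^ 2 * sin (5 * θ) =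
    -5 * axisNorm * otherForms (sin θ / axisNorm) (cos θ) := by
  have hn := axisNorm_pos.ne'
  have hs : axisNorm * (sin θ / axisNorm) = sin θ := mul_div_cancel₀ _ hn
  have hn2 : (sin θ / axisNorm) ^ 2 = (5 - √5) / 10 * sin θ ^ 2 := by
    rw [div_pow, axisNorm_sq, div_eq_iff (by positivity)]
    rw [goldenRatio_eq]
    linear_combination sin θ ^ 2 * (√5 - 3) / 40 * sqrt_five_sq
  have h2 : goldenRatio ^ 2 = (3 + √5) / 2 := by
    rw [goldenRatio_sq, goldenRatio_eq]; ring
  have hA : goldenRatio ^ 4 * (sin θ / axisNorm) ^ 2 - cos θ ^ 2 =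
      (2 + 2 / 5 * √5) * sin θ ^ 2 - 1 := by
    rw [hn2, cos_sq', show goldenRatio ^ 4 = (goldenRatio ^ 2) ^ 2 by ring, h2]
    linear_combination -(√5 + 1) / 40 * sin θ ^ 2 * sqrt_five_sq
  have hB : goldenRatio ^ 2 * cos θ ^ 2 - (sin θ / axisNorm) ^ 2 =
      (3 + √5) / 2 - (2 + 2 / 5 * √5) * sin θ ^ 2 := by
    rw [hn2, cos_sq', h2]
    ring
  rw [sin_five_mul, otherForms, hA, hB, h2]
  linear_combination sin θ * (sin θ ^ 2 - 4 / 5 * sin θ ^ 4) * sqrt_five_sq +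
    5 * ((2 + 2 / 5 * √5) * sin θ ^ 2 - 1) * ((3 + √5) / 2 - (2 + 2 / 5 * √5) * sin θ ^ 2) * hs

theorem sin_five_mul_eq_zero_iff (θ : ℝ) :
    sin (5 * θ) = 0 ↔ otherForms (sin θ / axisNorm) (cos θ) = 0 := by
  have h := goldenRatio_sq_mul_sin_five_mul θ
  have hn := axisNorm_pos.ne'
  have hφ := goldenRatio_ne_zero
  constructor
  · intro h0
    rw [h0, mul_zero] at h
    exact (mul_eq_zero.1 h.symm).resolve_left (by simpa using hn)
  · intro h0
    rw [h0, mul_zero] at h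
    exact (mul_eq_zero.1 h).resolve_left (pow_ne_zero 2 hφ)

theorem sin_five_mul_eq_zero_of_planeForm_eq_zero {i i' : Fin 3 × ℤˣ} (hne : i ≠ i') {θ : ℝ}
    (h : planeForm i' (circlePoint i θ) = 0) : sin (5 * θ) = 0 := by
  rw [sin_five_mul_eq_zero_iff, otherForms]
  rw [circlePoint, planeForm_rot] at h
  obtain ⟨j, hj⟩ : ∃ j, j = i'.1 - i.1 := ⟨_, rfl⟩
  rw [← hj] at h
  have hε := sign_mul_self i.2
  have hε' := sign_mul_self i'.2
  fin_cases j
  · have h1 : i'.1 = i.1 := (sub_eq_zero.1 hj.symm)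
    have h2 : i.2 = -i'.2 := by
      refine (Int.units_ne_iff_eq_neg).1 fun h2 => hne (Prod.ext h1.symm h2)
    have h3 : sin θ = 0 := by
      simp [planeForm, baseCircle, h2] at h
      rcases h with h | h | h
      · linarith [Real.sqrt_nonneg 5]
      · exact h
      · exact absurd h axisNorm_pos.ne'
    simp [h3]
  · simp [planeForm, baseCircle] at h
    refine mul_eq_zero_of_right _ ?_
    linear_combination (((i'.2 : ℤ) : ℝ) * goldenRatio * cos θ + sin θ / axisNorm) * h -
      goldenRatio ^ 2 * cos θ ^ 2 * hε'
  · simp [planeForm, baseCircle] at h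
    refine mul_eq_zero_of_left (mul_eq_zero_of_right _ ?_) _
    linear_combination (((i'.2 : ℤ) : ℝ) * goldenRatio *
        (((i.2 : ℤ) : ℝ) * goldenRatio * (sin θ / axisNorm)) + cos θ) * h -
      goldenRatio ^ 4 * (sin θ / axisNorm) ^ 2 * (((i.2 : ℤ) : ℝ) ^ 2 * hε' + hε)

/-- At unit vectors of the plane `y = ε φ x` the vector field is a constant multiple of the cross
product of the position and the normal vector `(φ, -ε, 0)`, multiplied by the product of the other
five forms. -/
theorem fieldComponent_plane {ε x z : ℝ} (hε : ε ^ 2 = 1)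
    (h1 : x ^ 2 + (ε * goldenRatio * x) ^ 2 + z ^ 2 = 1) :
    fieldComponent x (ε * goldenRatio * x) z =
        (2 * √5 - 5) * (2 * goldenRatio * otherForms x z) * (ε * z) ∧
      fieldComponent (ε * goldenRatio * x) z x =
        (2 * √5 - 5) * (2 * goldenRatio * otherForms x z) * (goldenRatio * z) ∧
      fieldComponent z x (ε * goldenRatio * x) =
        (2 * √5 - 5) * (2 * goldenRatio * otherForms x z) *
          (-ε * (1 + goldenRatio ^ 2) * x) := by
  have h1' : (ε * goldenRatio * x) ^ 2 + z ^ 2 + x ^ 2 = 1 := by linarith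
  have h1'' : z ^ 2 + x ^ 2 + (ε * goldenRatio * x) ^ 2 = 1 := by linarith
  -- Both sides are polynomials in `√5`, `x` and `z`, equal after reduction of powers of `√5`.
  have e2 := sqrt_five_sq
  have e3 : √5 ^ 3 = 5 * √5 := by rw [pow_succ, e2]
  have e4 : √5 ^ 4 = 25 := by rw [pow_succ, e3]; linear_combination 5 * e2
  have e5 : √5 ^ 5 = 25 * √5 := by rw [pow_succ, e4]
  have e6 : √5 ^ 6 = 125 := by rw [pow_succ, e5]; linear_combination 25 * e2
  have e7 : √5 ^ 7 = 125 * √5 := by rw [pow_succ, e6]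
  have e8 : √5 ^ 8 = 625 := by rw [pow_succ, e7]; linear_combination 125 * e2
  have e10 : √5 ^ 10 = 3125 := by rw [pow_succ, pow_succ, e8]; linear_combination 625 * e2
  have e9 : √5 ^ 9 = 625 * √5 := by rw [pow_succ, e8]
  rw [fieldComponent, fieldComponent, fieldComponent, h1, h1', h1'', one_pow, div_one, div_one,
    div_one, otherForms, goldenRatio_eq]
  rcases sq_eq_one_iff.1 hε with rfl | rfl <;>
  refine ⟨?_, ?_, ?_⟩ <;> ring_nf <;> simp only [e2, e3, e4, e5, e6, e7, e8, e9, e10] <;> ring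

theorem isFixedPoint_circlePoint (i : Fin 3 × ℤˣ) (θ : ℝ) :
    IsFixedPoint (circlePoint i θ) ↔ sin (5 * θ) = 0 := by
  rw [circlePoint, isFixedPoint_rot, sin_five_mul_eq_zero_iff, isFixedPoint_iff]
  have hnorm : inner ℝ (baseCircle i.2 θ) (baseCircle i.2 θ) = (1 : ℝ) := by
    rw [inner_baseCircle]; simp
  rw [inner_eq] at hnorm
  have hε : ((i.2 : ℤ) : ℝ) ^ 2 = 1 := by rw [sq, sign_mul_self]
  have hx : baseCircle i.2 θ 0 = sin θ / axisNorm := rfl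
  have hz : baseCircle i.2 θ 2 = cos θ := rfl
  have hy : baseCircle i.2 θ 1 = ((i.2 : ℤ) : ℝ) * goldenRatio * (sin θ / axisNorm) := rfl
  rw [hx, hy, hz] at hnorm
  obtain ⟨c1, c2, c3⟩ := fieldComponent_plane (x := sin θ / axisNorm) (z := cos θ) hε
    (by linarith)
  have hall : (∀ k : Fin 3, fieldComponent (baseCircle i.2 θ k) (baseCircle i.2 θ (k + 1))
      (baseCircle i.2 θ (k + 2)) = 0) ↔
      fieldComponent (sin θ / axisNorm) (((i.2 : ℤ) : ℝ) * goldenRatio * (sin θ / axisNorm))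
        (cos θ) = 0 ∧
      fieldComponent (((i.2 : ℤ) : ℝ) * goldenRatio * (sin θ / axisNorm)) (cos θ)
        (sin θ / axisNorm) = 0 ∧
      fieldComponent (cos θ) (sin θ / axisNorm)
        (((i.2 : ℤ) : ℝ) * goldenRatio * (sin θ / axisNorm)) = 0 := by
    simp [Fin.forall_fin_succ, hx, hy, hz]
  rw [hall, c1, c2, c3]
  constructor
  · rintro ⟨-, h2, h3⟩
    by_contra h0
    have h5 : (2 * √5 - 5 : ℝ) ≠ 0 := by
      intro h
      have := sqrt_five_sq
      have h' : √5 = 5 / 2 := by linarith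
      rw [h'] at this
      norm_num at this
    have hφ := goldenRatio_ne_zero
    have hK : (2 * √5 - 5) * (2 * goldenRatio * otherForms (sin θ / axisNorm) (cos θ)) ≠ 0 :=
      mul_ne_zero h5 (mul_ne_zero (mul_ne_zero two_ne_zero hφ) h0)
    have hcos : cos θ = 0 :=
      (mul_eq_zero.1 ((mul_eq_zero.1 h2).resolve_left hK)).resolve_left hφ
    have hε0 : -((i.2 : ℤ) : ℝ) * (1 + goldenRatio ^ 2) ≠ 0 :=
      mul_ne_zero (neg_ne_zero.2 (by exact_mod_cast i.2.ne_zero)) (by positivity)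
    have hsin := (mul_eq_zero.1 ((mul_eq_zero.1 h3).resolve_left hK)).resolve_left hε0
    rw [hcos, hsin] at hnorm
    norm_num at hnorm
  · intro h
    simp [h]

/-! ### The sixty arcs -/

/-- The tenth part of the great circle `circlePoint i` that starts at the angle `m * (π / 5)`. -/
def edgeArc (e : (Fin 3 × ℤˣ) × Fin 10) : GreatCircleArc where
  u := circlePoint e.1 ((e.2 : ℕ) * (π / 5))
  v := circlePoint e.1 ((e.2 : ℕ) * (π / 5) + π / 2)
  length := π / 5
  norm_u := norm_circlePoint _ _
  norm_v := norm_circlePoint _ _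
  inner_eq_zero := by rw [inner_circlePoint]; simp
  length_pos := by positivity
  length_lt := by linarith [Real.pi_pos]

theorem edgeArc_param (e : (Fin 3 × ℤˣ) × Fin 10) (t : ℝ) :
    (edgeArc e).param t = circlePoint e.1 ((e.2 : ℕ) * (π / 5) + t) :=
  cos_smul_circlePoint_add _ _ _

theorem sin_five_mul_add_eq_zero_iff (m : ℕ) (t : ℝ) :
    sin (5 * (m * (π / 5) + t)) = 0 ↔ sin (5 * t) = 0 := by
  have h : 5 * (m * (π / 5) + t) = 5 * t + m * π := by ring
  rw [h, sin_add_nat_mul_pi]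
  simp

theorem eq_or_eq_of_sin_five_mul_eq_zero {t : ℝ} (h0 : 0 ≤ t) (h1 : t ≤ π / 5)
    (h : sin (5 * t) = 0) : t = 0 ∨ t = π / 5 := by
  by_contra! hne
  have h2 : 0 < t := lt_of_le_of_ne h0 hne.1.symm
  have h3 : t < π / 5 := lt_of_le_of_ne h1 hne.2
  exact (sin_pos_of_pos_of_lt_pi (by linarith) (by linarith)).ne' h

theorem isFixedPoint_edgeArc_param (e : (Fin 3 × ℤˣ) × Fin 10) (t : ℝ) :
    IsFixedPoint ((edgeArc e).param t) ↔ sin (5 * t) = 0 := by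
  rw [edgeArc_param, isFixedPoint_circlePoint, sin_five_mul_add_eq_zero_iff]

theorem edgeArc_param_mem_endpoints (e : (Fin 3 × ℤˣ) × Fin 10) {t : ℝ} (h : t = 0 ∨ t = π / 5) :
    (edgeArc e).param t ∈ (edgeArc e).endpoints := by
  rcases h with rfl | rfl
  · exact Or.inl rfl
  · exact Or.inr rfl

/-- Equal points of two arcs are fixed points, hence endpoints, if the arcs lie on different
circles, and are endpoints by comparison of angles if the arcs lie on the same circle. -/
theorem eq_or_eq_of_edgeArc_param_eq {e e' : (Fin 3 × ℤˣ) × Fin 10} (hne : e ≠ e') {t t' : ℝ}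
    (ht : t ∈ Icc 0 (π / 5)) (ht' : t' ∈ Icc 0 (π / 5))
    (h : (edgeArc e).param t = (edgeArc e').param t') : t = 0 ∨ t = π / 5 := by
  rw [edgeArc_param, edgeArc_param] at h
  by_cases hi : e.1 = e'.1
  · have hm : (e.2 : ℕ) ≠ e'.2 := fun hm => hne (Prod.ext hi (Fin.ext hm))
    have hcos : cos (((e.2 : ℕ) * (π / 5) + t) - ((e'.2 : ℕ) * (π / 5) + t')) = 1 := by
      rw [← inner_circlePoint e'.1, ← h, hi, inner_circlePoint]; simp
    obtain ⟨k, hk⟩ := (cos_eq_one_iff _).1 hcos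
    have hπ : 0 < π / 5 := by positivity
    -- The difference of the two parameters is an integral multiple of `π / 5`.
    obtain ⟨l, hl⟩ : ∃ l : ℤ, l = 10 * k - (e.2 : ℕ) + (e'.2 : ℕ) := ⟨_, rfl⟩
    have hlt : t - t' = l * (π / 5) := by
      rw [hl]; push_cast; linarith
    have h1 : (l : ℝ) ≤ 1 := by
      by_contra! hcon
      nlinarith [ht.1, ht.2, ht'.1, ht'.2]
    have h2 : (-1 : ℝ) ≤ l := by
      by_contra! hcon
      nlinarith [ht.1, ht.2, ht'.1, ht'.2]
    have h1' : l ≤ 1 := by exact_mod_cast h1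
    have h2' : -1 ≤ l := by exact_mod_cast h2
    have hl0 : l ≠ 0 := by
      have := e.2.isLt
      have := e'.2.isLt
      omega
    obtain hl1 | hl1 : l = 1 ∨ l = -1 := by omega
    · right
      rw [hl1] at hlt
      push_cast at hlt
      linarith [ht.2, ht'.1]
    · left
      rw [hl1] at hlt
      push_cast at hlt
      linarith [ht.1, ht'.2]
  · have hsin := sin_five_mul_eq_zero_of_planeForm_eq_zero hi
      (h ▸ planeForm_circlePoint e'.1 _)
    rw [sin_five_mul_add_eq_zero_iff] at hsin
    exact eq_or_eq_of_sin_five_mul_eq_zero ht.1 ht.2 hsin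

theorem exists_mem_edgeArc {i : Fin 3 × ℤˣ} {θ : ℝ} (h0 : 0 ≤ θ) (h1 : θ < 2 * π) :
    ∃ m, circlePoint i θ ∈ (edgeArc (i, m)).carrier := by
  have hπ : 0 < π / 5 := by positivity
  have hfl := Nat.floor_le (div_nonneg h0 hπ.le)
  have hlt := Nat.lt_floor_add_one (θ / (π / 5))
  rw [le_div_iff₀ hπ] at hfl
  rw [div_lt_iff₀ hπ] at hlt
  have hm : ⌊θ / (π / 5)⌋₊ < 10 := by
    rw [Nat.floor_lt (div_nonneg h0 hπ.le), div_lt_iff₀ hπ]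
    push_cast
    linarith
  refine ⟨⟨_, hm⟩, θ - ⌊θ / (π / 5)⌋₊ * (π / 5), ⟨by linarith, ?_⟩, ?_⟩
  · change _ ≤ π / 5
    linarith
  · rw [edgeArc_param]
    congr 1
    simp

theorem consistsOfFixedPointArcs : ConsistsOfFixedPointArcs 60 (unitSphere ∩ surfaceT 0) := by
  have hcard : Fintype.card ((Fin 3 × ℤˣ) × Fin 10) = 60 := by
    simp [Fintype.card_prod]
  let E := (Fintype.equivFinOfCardEq hcard).symm
  refine ⟨fun n => edgeArc (E n), fun n p hp => ?_, fun n p hp => ?_, fun n n' hne p hp => ?_, ?_⟩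
  · rcases hp with rfl | rfl
    · rw [isFixedPoint_edgeArc_param]; simp
    · rw [isFixedPoint_edgeArc_param]
      change sin (5 * (π / 5)) = 0
      rw [mul_div_cancel₀ _ (by norm_num : (5 : ℝ) ≠ 0), sin_pi]
  · obtain ⟨t, ⟨h0, h1⟩, rfl⟩ := hp
    change t < π / 5 at h1
    rw [isFixedPoint_edgeArc_param]
    exact (sin_pos_of_pos_of_lt_pi (by linarith) (by linarith)).ne'
  · obtain ⟨⟨t, ht, rfl⟩, ⟨t', ht', h⟩⟩ := hp
    have hE : E n ≠ E n' := fun h => hne (E.injective h)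
    refine ⟨edgeArc_param_mem_endpoints _ (eq_or_eq_of_edgeArc_param_eq hE ht ht' h.symm), ?_⟩
    rw [← h]
    exact edgeArc_param_mem_endpoints _ (eq_or_eq_of_edgeArc_param_eq hE.symm ht' ht h)
  · ext p
    simp only [mem_inter_iff, mem_iUnion]
    constructor
    · rintro ⟨hp, hV⟩
      obtain ⟨i, hi⟩ := exists_planeForm_eq_zero hV
      obtain ⟨θ, h0, h1, rfl⟩ := exists_circlePoint_eq hp hi
      obtain ⟨m, hm⟩ := exists_mem_edgeArc (i := i) h0 h1
      exact ⟨E.symm (i, m), by rwa [E.apply_symm_apply]⟩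
    · rintro ⟨n, t, -, rfl⟩
      rw [edgeArc_param]
      exact ⟨mem_unitSphere.2 (norm_circlePoint _ _),
        V_eq_zero_of_planeForm_eq_zero (planeForm_circlePoint _ _)⟩

end Icosahedral

end

theorem mainTheorem7 :
    Real.goldenRatio ^ 3 = 2 + √5 ∧
    ∀ ξ : ℝ,
      (ξ < -((2 + √5) / 5) →
        Icosahedral.unitSphere ∩ Icosahedral.surfaceT ξ = ∅) ∧
      (ξ = -((2 + √5) / 5) →
        Icosahedral.ConsistsOfIsolatedPoints 12
          (Icosahedral.unitSphere ∩ Icosahedral.surfaceT ξ)) ∧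
      (-((2 + √5) / 5) < ξ → ξ < 0 →
        Icosahedral.ConsistsOfDisjointCircles 12
          (Icosahedral.unitSphere ∩ Icosahedral.surfaceT ξ)) ∧
      (ξ = 0 →
        Icosahedral.ConsistsOfFixedPointArcs 60
          (Icosahedral.unitSphere ∩ Icosahedral.surfaceT ξ)) ∧
      (0 < ξ → ξ < (2 + √5) / 27 →
        Icosahedral.ConsistsOfDisjointCircles 20
          (Icosahedral.unitSphere ∩ Icosahedral.surfaceT ξ)) ∧
      (ξ = (2 + √5) / 27 →
        Icosahedral.ConsistsOfIsolatedPoints 20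
          (Icosahedral.unitSphere ∩ Icosahedral.surfaceT ξ)) ∧
      ((2 + √5) / 27 < ξ →
        Icosahedral.unitSphere ∩ Icosahedral.surfaceT ξ = ∅) := by
  have hP := Icosahedral.isFaceFamily_pentagons
  have hT := Icosahedral.isFaceFamily_triangles
  have hP0 : (0 : ℝ) < (2 + √5) / 5 := by positivity
  have hT0 : (0 : ℝ) < (2 + √5) / 27 := by positivity
  have hcP := Icosahedral.card_pentagons
  have hcT := Icosahedral.card_triangles
  have hneg : ∀ ξ : ℝ, (((-1 : ℤˣ) : ℤ) : ℝ) * -ξ = ξ := fun ξ => by simp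
  have hone : ∀ ξ : ℝ, (((1 : ℤˣ) : ℤ) : ℝ) * ξ = ξ := fun ξ => by simp
  refine ⟨Icosahedral.goldenRatio_cubed, fun ξ => ⟨fun h => ?_, fun h => ?_, fun h h0 => ?_,
    fun h => ?_, fun h0 h => ?_, fun h => ?_, fun h => ?_⟩⟩
  · rw [← hneg ξ]
    exact hP.inter_eq_empty hP0 (by linarith)
  · rw [← hneg ξ, ← hcP, h, neg_neg]
    exact hP.consistsOfIsolatedPoints hP0
  · rw [← hneg ξ, ← hcP]
    exact hP.consistsOfDisjointCircles (by linarith) (by linarith)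
  · rw [h]
    exact Icosahedral.consistsOfFixedPointArcs
  · rw [← hone ξ, ← hcT]
    exact hT.consistsOfDisjointCircles h0 h
  · rw [← hone ξ, ← hcT, h]
    exact hT.consistsOfIsolatedPoints hT0
  · rw [← hone ξ]
    exact hT.inter_eq_empty hT0 h
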